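/- A stochastic combinatorial semi-bandit is a tuple $B=(E,\Theta,P)$, where $E=\{1,\dots,L\}$ is a set of $L$ items, $\Theta\subseteq 2^E$ is a nonempty family of feasible sets (solutions), and $P$ is a probability distribution on $[0,1]^E$. Write $\bar w=\mathbb E_{w\sim P}[w]$ and $f(A,w)=\sum_{e\in A}w(e)$. A solution $A^\ast\in\Theta$ is optimal if it maximizes $f(\cdot,\bar w)$ over $\Theta$; the other solutions are suboptimal. Let $w_1,w_2,\dots$ be i.i.d. with law $P$. A (possibly randomized) algorithm knows $E$ and $\Theta$ but not $P$; at each time $t$ it chooses $A_t\in\Theta$ on the basis of its previous choices and observations, and then observes $\{(e,w_t(e)):e\in A_t\}$. Its expected cumulative regret in $n$ steps is $$R(n)=\mathbb E\Big[\sum_{t=1}^n\big(f(A^\ast,w_t)-f(A_t,w_t)\big)\Big],$$ and $T_n(A)$ denotes the number of times that solution $A$ is chosen in $n$ steps. The algorithm is consistent if for every stochastic combinatorial semi-bandit with a unique optimal solution, every suboptimal solution $A\in\Theta$ and every $\alpha>0$, $\mathbb E[T_n(A)]=o(n^\alpha)$ as $n\to\infty$. Let $L,K\ge 1$ be integers such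 that $L/K$ is an integer, and let $\Delta$ be a real number with $0<\Delta/K<1/2$. The $K$-path semi-bandit has $E=\{1,\dots,L\}$; its feasible solutions are the $L/K$ paths, where path $j$ is $\{(j-1)K+1,\dots,jK\}$; the weights of the items in the same path are equal, the weights in different paths are independent, and the weight of item $e$ is a Bernoulli random variable with mean $1/2$ if $e$ belongs to path $1$ and mean $1/2-\Delta/K$ otherwise. **Proposition.** The regret of any consistent algorithm on the $K$-path semi-bandit satisfies $$\liminf_{n\to\infty}\frac{R(n)}{\log n}\ \ge\ \frac{(L-K)K}{4\Delta}.$$ -/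

import Mathlib

open MeasureTheory ProbabilityTheory Filter Asymptotics
open scoped Topology

noncomputable section

namespace SemiBandit

/-- A realization `w ∈ [0, 1]^E` of the item weights, over the ground set `E = Fin L`. -/
abbrev Weights (L : ℕ) : Type := Fin L → unitInterval

/-- The return `f(A, u) = ∑_{e ∈ A} u(e)` of the set of items `A` under the weights `u`. -/
def ret {L : ℕ} (A : Finset (Fin L)) (u : Fin L → ℝ) : ℝ := ∑ e ∈ A, u e

/-- A stochastic combinatorial semi-bandit `(E, Θ, P)` with ground set `E = Fin L`, nonempty
feasible set `Θ ⊆ 2^E`, and probability distribution `P` over the unit cube `[0, 1]^E`. -/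
structure Bandit (L : ℕ) where
  Θ : Finset (Finset (Fin L))
  nonempty : Θ.Nonempty
  P : ProbabilityMeasure (Weights L)

namespace Bandit

variable {L : ℕ} (B : Bandit L)

/-- The expected weight `w̄(e)` of item `e`. -/
def mean (e : Fin L) : ℝ := ∫ w, (w e : ℝ) ∂(B.P : Measure (Weights L))

/-- `A` is an optimal solution: it is feasible and maximizes `f(·, w̄)` over `Θ`. -/
def IsOptimal (A : Finset (Fin L)) : Prop :=
  A ∈ B.Θ ∧ ∀ A' ∈ B.Θ, ret A' B.mean ≤ ret A B.mean

theorem exists_isOptimal : ∃ A, B.IsOptimal A :=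
  B.Θ.exists_max_image (fun A => ret A B.mean) B.nonempty

/-- The optimal solution `A* = argmax_{A ∈ Θ} f(A, w̄)`. -/
def optimal : Finset (Fin L) := B.exists_isOptimal.choose

/-- The optimal solution is unique. -/
def HasUniqueOptimum : Prop := ∃! A, B.IsOptimal A

end Bandit

/-- A step of the interaction: the chosen solution, together with a vector of weights. -/
abbrev Round {L : ℕ} (Θ : Finset (Finset (Fin L))) : Type := Θ × Weights L

/-- What the agent sees in a step: the chosen solution `A` and the pairs `(e, w(e))`, `e ∈ A`.
Unobserved weights are overwritten by `0`. -/
def observe {L : ℕ} {Θ : Finset (Finset (Fin L))} (r : Round Θ) : Round Θ :=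
  (r.1, fun e => if e ∈ r.1.1 then r.2 e else 0)

theorem measurable_observe {L : ℕ} {Θ : Finset (Finset (Fin L))} :
    Measurable (observe (Θ := Θ)) := by
  refine measurable_from_prod_countable_right fun A => ?_
  refine measurable_const.prodMk (measurable_pi_lambda _ fun e => ?_)
  by_cases h : e ∈ A.1
  · simpa [h] using measurable_pi_apply e
  · simp [h]

/-- A (possibly randomized) policy for the feasible set `Θ`: for every `t`, a probability
distribution over `Θ` for the solution chosen after `t` completed steps, as a measurable function
of the solutions chosen and the weights observed in these steps. -/
structure Policy {L : ℕ} (Θ : Finset (Finset (Fin L))) where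
  choose : (t : ℕ) → Kernel (Fin t → Round Θ) Θ
  markov : ∀ t, IsMarkovKernel (choose t)

/-- A learning algorithm gets the ground set and a nonempty feasible set, but not the
distribution of the weights. -/
def Algorithm : Type :=
  (L : ℕ) → (Θ : Finset (Finset (Fin L))) → Θ.Nonempty → Policy Θ

namespace Policy

variable {L : ℕ} {Θ : Finset (Finset (Fin L))} (π : Policy Θ) (P : ProbabilityMeasure (Weights L))

/-- The conditional law of the next step `(A_t, w_t)` given the previous steps: `A_t` is drawn by
the policy from the observations, and `w_t ∼ P` is independent of `A_t` and of the past. -/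
def step (t : ℕ) : Kernel (Fin t → Round Θ) (Round Θ) :=
  (π.choose t).comap (fun h i => observe (h i))
      (measurable_pi_lambda _ fun i => measurable_observe.comp (measurable_pi_apply i))
    ×ₖ Kernel.const _ (P : Measure (Weights L))

/-- The joint law of `(A_1, w_1), …, (A_n, w_n)`. -/
def law : (n : ℕ) → Measure (Fin n → Round Θ)
  | 0 => Measure.dirac Fin.elim0
  | n + 1 => ((law n) ⊗ₘ (π.step P n)).map
      fun p => Fin.snoc (α := fun _ => Round Θ) p.1 p.2

instance isMarkovKernel_step (t : ℕ) : IsMarkovKernel (π.step P t) := by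
  have := π.markov t
  unfold step
  infer_instance

theorem measurable_snoc {n : ℕ} :
    Measurable fun p : (Fin n → Round Θ) × Round Θ =>
      Fin.snoc (α := fun _ => Round Θ) p.1 p.2 := by
  refine measurable_pi_lambda _ fun i => ?_
  refine Fin.lastCases ?_ (fun j => ?_) i
  · simpa using measurable_snd
  · simpa [Function.comp_def] using (measurable_pi_apply j).comp measurable_fst

instance isProbabilityMeasure_law : (n : ℕ) → IsProbabilityMeasure (π.law P n)
  | 0 => by unfold law; infer_instance
  | n + 1 => by
      have := isProbabilityMeasure_law n
      exact Measure.isProbabilityMeasure_map measurable_snoc.aemeasurable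

end Policy

namespace Algorithm

variable (alg : Algorithm) {L : ℕ} (B : Bandit L)

/-- The joint law of the first `n` steps when the algorithm is run on the semi-bandit `B`. -/
def law (n : ℕ) : Measure (Fin n → Round B.Θ) := (alg L B.Θ B.nonempty).law B.P n

/-- The expected cumulative regret `R(n) = 𝔼[∑_{t=1}^n (f(A*, w_t) - f(A_t, w_t))]`. -/
def regret (n : ℕ) : ℝ :=
  ∫ h, ∑ t, (ret B.optimal (fun e => ((h t).2 e : ℝ)) -
    ret (h t).1.1 (fun e => ((h t).2 e : ℝ))) ∂(alg.law B n)

/-- The expectation `𝔼[T_n(A)]` of the number of times that `A` is chosen in `n` steps. -/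
def expectedCount (A : Finset (Fin L)) (n : ℕ) : ℝ :=
  ∫ h, ((Finset.univ.filter fun t => (h t).1.1 = A).card : ℝ) ∂(alg.law B n)

/-- The algorithm is consistent: on every stochastic combinatorial semi-bandit (with a unique
optimal solution), `𝔼[T_n(A)] = o(n^α)` for every suboptimal solution `A` and every `α > 0`. -/
def IsConsistent : Prop :=
  ∀ (L : ℕ) (B : Bandit L), B.HasUniqueOptimum →
    ∀ A ∈ B.Θ, ¬ B.IsOptimal A → ∀ α : ℝ, 0 < α →
      (fun n : ℕ => alg.expectedCount B A n) =o[atTop] (fun n : ℕ => (n : ℝ) ^ α)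

end Algorithm

/-! The `K`-path semi-bandit. Items and paths are numbered from `0`, so that path `j` consists of
the items `j K, …, j K + K - 1`, and the distinguished first path is path `0`. -/

/-- The `j`-th path. -/
def path (L K j : ℕ) : Finset (Fin L) := Finset.univ.filter fun e => e.val / K = j

/-- The index of the path of item `e`. -/
def pathIndex {L K : ℕ} (hdvd : K ∣ L) (e : Fin L) : Fin (L / K) :=
  ⟨e.val / K, Nat.div_lt_div_of_lt_of_dvd hdvd e.isLt⟩

/-- The mean weight `1/2` of the items of path `0`, and `1/2 - Δ/K` of all other items. -/
def pathMean (K : ℕ) (Δ : ℝ) (h0 : 0 < Δ / K) (h1 : Δ / K < 1 / 2) (j : ℕ) : unitInterval :=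
  ⟨if j = 0 then 1 / 2 else 1 / 2 - Δ / K, by split_ifs <;> constructor <;> linarith⟩

/-- The distribution of the weights: independent Bernoulli variables `X_j`, one for each path,
and `w(e) = X_j` for all items `e` of path `j`. -/
def pathLaw {L K : ℕ} (hdvd : K ∣ L) (Δ : ℝ) (h0 : 0 < Δ / K) (h1 : Δ / K < 1 / 2) :
    Measure (Weights L) :=
  (Measure.pi fun j : Fin (L / K) =>
      (bernoulliMeasure 1 0 (pathMean K Δ h0 h1 j) : Measure unitInterval)).map
    fun x e => x (pathIndex hdvd e)

instance isProbabilityMeasure_pathLaw {L K : ℕ} (hdvd : K ∣ L) (Δ : ℝ) (h0 : 0 < Δ / K)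
    (h1 : Δ / K < 1 / 2) : IsProbabilityMeasure (pathLaw hdvd Δ h0 h1) :=
  Measure.isProbabilityMeasure_map
    (measurable_pi_lambda _ fun e => measurable_pi_apply (pathIndex hdvd e)).aemeasurable

/-- The `K`-path semi-bandit with `L` items, gap `Δ`, and the `L / K` paths as its solutions. -/
def kPath {L K : ℕ} (hL : 0 < L) (hdvd : K ∣ L) (Δ : ℝ) (h0 : 0 < Δ / K)
    (h1 : Δ / K < 1 / 2) : Bandit L where
  Θ := (Finset.range (L / K)).image (path L K)
  nonempty := by
    have : 0 < L / K := Nat.div_pos (Nat.le_of_dvd hL hdvd) (Nat.pos_of_dvd_of_pos hdvd hL)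
    exact ⟨_, Finset.mem_image_of_mem _ (Finset.mem_range.2 this)⟩
  P := ⟨pathLaw hdvd Δ h0 h1, inferInstance⟩

end SemiBandit

end

/-! The proof is a change of measure. Fix a path `j` other than path `0` and raise its mean to `q' =
1/2 + ε`, which makes it the unique optimum. Under the changed law, consistency makes all other
paths rare; under the original law, `j` itself is rare. The two laws of the observations differ only
through visits to `j`, so these visits must carry about `log n` of information.

Information per visit is measured by the chi-square divergence `E_P[1/ρ - 1]`, `ρ = dP'/dP`, which
dominates the Kullback-Leibler divergence. For Bernoulli laws it equals `(μ j - q')² / (q' (1 -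
q'))`, which tends to `4 (Δ/K)²` as `ε → 0`. Hence every suboptimal path is visited at least about
`K² log n / (4 Δ²)` times. Each visit costs `Δ`, and the `L/K - 1` suboptimal paths together give
`(L - K) K / (4 Δ)`.

The main lemmas are `lintegral_law_observe` (likelihood ratio of histories), `information_le`
(information inequality), `isRatio_pathBandit` (the ratio for paths) and
`eventually_mul_log_le_expectedCount` (logarithmic visits). -/

open scoped ENNReal

namespace SemiBandit

/-! ### Change of measure for observed histories. -/

namespace Policy

variable {L : ℕ} {Θ : Finset (Finset (Fin L))} (π : Policy Θ)

theorem measurable_observe_history {n : ℕ} :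
    Measurable fun (h : Fin n → Round Θ) i => observe (h i) :=
  measurable_pi_lambda _ fun i => measurable_observe.comp (measurable_pi_apply i)

theorem lintegral_step (P : ProbabilityMeasure (Weights L)) (n : ℕ) (h : Fin n → Round Θ)
    {F : Round Θ → ℝ≥0∞} (hF : Measurable F) :
    ∫⁻ r, F r ∂(π.step P n h) =
      ∫⁻ A, ∫⁻ w, F (A, w) ∂(P : Measure (Weights L)) ∂(π.choose n fun i => observe (h i)) := by
  have := π.markov n
  rw [step, Kernel.lintegral_prod _ _ _ hF]
  simp [Kernel.comap_apply]

theorem lintegral_law_succ (P : ProbabilityMeasure (Weights L)) (n : ℕ)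
    {F : (Fin (n + 1) → Round Θ) → ℝ≥0∞} (hF : Measurable F) :
    ∫⁻ h, F h ∂(π.law P (n + 1)) =
      ∫⁻ h, ∫⁻ r, F (Fin.snoc (α := fun _ => Round Θ) h r) ∂(π.step P n h) ∂(π.law P n) := by
  rw [law, lintegral_map hF measurable_snoc, Measure.lintegral_compProd
    (f := fun p => F (Fin.snoc (α := fun _ => Round Θ) p.1 p.2)) (hF.comp measurable_snoc)]

/-- The likelihood ratio of a round, when only the weights observed with `a` change their law. -/
def roundRatio (a : Θ) (ρ : Weights L → ℝ) (r : Round Θ) : ℝ := if r.1 = a then ρ r.2 else 1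

theorem measurable_roundRatio (a : Θ) {ρ : Weights L → ℝ} (hρ : Measurable ρ) :
    Measurable (roundRatio a ρ) :=
  Measurable.ite (measurable_fst (measurableSet_singleton a)) (hρ.comp measurable_snd)
    measurable_const

/-- `ρ` is the density, on the weights observed with `a`, of `P'` with respect to `P`, and the
weights observed with any other solution have the same law under `P` and `P'`. -/
def IsRatio (P P' : ProbabilityMeasure (Weights L)) (a : Θ) (ρ : Weights L → ℝ) : Prop :=
  ∀ (A : Θ) (g : Round Θ → ℝ≥0∞), Measurable g →
    ∫⁻ w, g (observe (A, w)) ∂(P' : Measure (Weights L)) =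
      ∫⁻ w, g (observe (A, w)) * ENNReal.ofReal (roundRatio a ρ (A, w))
        ∂(P : Measure (Weights L))

theorem observe_snoc {n : ℕ} (h : Fin n → Round Θ) (r : Round Θ) :
    (fun i => observe (Fin.snoc (α := fun _ => Round Θ) h r i)) =
      Fin.snoc (α := fun _ => Round Θ) (fun i => observe (h i)) (observe r) := by
  funext i
  refine Fin.lastCases ?_ (fun j => ?_) i <;> simp

theorem measurable_historyRatio (a : Θ) {ρ : Weights L → ℝ} (hρ : Measurable ρ) (n : ℕ) :
    Measurable fun h : Fin n → Round Θ => ∏ i, ENNReal.ofReal (roundRatio a ρ (h i)) :=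
  Finset.measurable_prod _ fun i _ =>
    ((measurable_roundRatio a hρ).comp (measurable_pi_apply i)).ennreal_ofReal

/-- The policy reads only observations, so its choice probabilities are the same under both laws and
cancel. Each round contributes the factor `roundRatio`, by induction on the number of rounds. -/
theorem lintegral_law_observe {P P' : ProbabilityMeasure (Weights L)} {a : Θ}
    {ρ : Weights L → ℝ} (hρ : Measurable ρ) (hr : IsRatio P P' a ρ) (n : ℕ) :
    ∀ {F : (Fin n → Round Θ) → ℝ≥0∞}, Measurable F →
    ∫⁻ h, F (fun i => observe (h i)) ∂(π.law P' n) =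
      ∫⁻ h, F (fun i => observe (h i)) * ∏ i, ENNReal.ofReal (roundRatio a ρ (h i))
        ∂(π.law P n) := by
  induction n with
  | zero => intro F hF; simp [law]
  | succ n ih =>
    intro F hF
    have := π.markov n
    have hS : Measurable fun p : (Fin n → Round Θ) × Round Θ =>
        F (Fin.snoc (α := fun _ => Round Θ) p.1 (observe p.2)) :=
      hF.comp (measurable_snoc.comp (measurable_fst.prodMk (measurable_observe.comp measurable_snd)))
    have hR := (measurable_roundRatio a hρ).ennreal_ofReal
    have hS' : Measurable fun p : (Fin n → Round Θ) × Round Θ =>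
        F (Fin.snoc (α := fun _ => Round Θ) p.1 (observe p.2)) *
          ENNReal.ofReal (roundRatio a ρ p.2) := hS.mul (hR.comp measurable_snd)
    -- `G` has the last round integrated out with the kernel evaluated at `h` itself. At an observed
    -- history it is the conditional expectation, so the induction hypothesis applies to it.
    let G : (Fin n → Round Θ) → ℝ≥0∞ := fun h =>
      ∫⁻ A, ∫⁻ w, F (Fin.snoc (α := fun _ => Round Θ) h (observe (A, w))) *
          ENNReal.ofReal (roundRatio a ρ (A, w)) ∂(P : Measure (Weights L)) ∂(π.choose n h)
    have hG : Measurable G := by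
      have h3 : Measurable fun q : ((Fin n → Round Θ) × Θ) × Weights L =>
          F (Fin.snoc (α := fun _ => Round Θ) q.1.1 (observe (q.1.2, q.2))) *
            ENNReal.ofReal (roundRatio a ρ (q.1.2, q.2)) :=
        hS'.comp (measurable_fst.fst.prodMk (measurable_fst.snd.prodMk measurable_snd))
      exact h3.lintegral_prod_right'.lintegral_kernel_prod_right'
    rw [lintegral_law_succ _ _ _ (F := fun h => F fun i => observe (h i))
        (hF.comp measurable_observe_history),
      lintegral_law_succ _ _ _ (F := fun h => F (fun i => observe (h i)) *
        ∏ i, ENNReal.ofReal (roundRatio a ρ (h i))) ((hF.comp measurable_observe_history).mul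
        (measurable_historyRatio a hρ _))]
    have h1 : ∀ h, ∫⁻ r, F (fun i => observe (Fin.snoc (α := fun _ => Round Θ) h r i))
        ∂(π.step P' n h) = G (fun i => observe (h i)) := by
      intro h
      simp only [observe_snoc]
      rw [lintegral_step _ _ _ _ (F := fun r => F (Fin.snoc (α := fun _ => Round Θ)
        (fun i => observe (h i)) (observe r))) (hS.comp (measurable_const (a := fun i => observe (h i))
        |>.prodMk measurable_id))]
      refine lintegral_congr fun A => ?_
      exact hr A (fun r => F (Fin.snoc (α := fun _ => Round Θ) (fun i => observe (h i)) r))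
        (hF.comp (measurable_snoc.comp (measurable_const (a := fun i => observe (h i))
          |>.prodMk measurable_id)))
    simp only [h1]
    rw [ih hG]
    refine lintegral_congr fun h => ?_
    have h2 : ∀ r, F (fun i => observe (Fin.snoc (α := fun _ => Round Θ) h r i)) *
        ∏ i, ENNReal.ofReal (roundRatio a ρ (Fin.snoc (α := fun _ => Round Θ) h r i)) =
        F (Fin.snoc (α := fun _ => Round Θ) (fun i => observe (h i)) (observe r)) *
          ENNReal.ofReal (roundRatio a ρ r) * ∏ i, ENNReal.ofReal (roundRatio a ρ (h i)) := by
      intro r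
      rw [observe_snoc, Fin.prod_univ_castSucc]
      simp only [Fin.snoc_castSucc, Fin.snoc_last]
      ring
    simp only [h2]
    have h4 : Measurable fun r => F (Fin.snoc (α := fun _ => Round Θ)
        (fun i => observe (h i)) (observe r)) * ENNReal.ofReal (roundRatio a ρ r) :=
      hS'.comp (measurable_const (a := fun i => observe (h i)) |>.prodMk measurable_id)
    rw [lintegral_mul_const _ h4, lintegral_step _ _ _ _ h4]

/-- In every step the weights are independent of the chosen solution, with law `P`. -/
theorem map_law_apply (P : ProbabilityMeasure (Weights L)) (n : ℕ) (t : Fin n) :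
    (π.law P n).map (fun h => h t) =
      ((π.law P n).map fun h => (h t).1).prod (P : Measure (Weights L)) := by
  induction n with
  | zero => exact t.elim0
  | succ n ih =>
    have := π.markov n
    have hm : ∀ {m : ℕ} (s : Fin m), Measurable fun h : Fin m → Round Θ => h s :=
      fun s => measurable_pi_apply s
    refine Fin.lastCases ?_ (fun s => ?_) t
    · refine Measure.ext_of_lintegral _ fun F hF => ?_
      rw [lintegral_map hF (hm _), lintegral_prod _ hF.aemeasurable,
        lintegral_map hF.lintegral_prod_right' (hm _).fst,
        lintegral_law_succ _ _ _ (F := fun h => F (h (Fin.last n))) (hF.comp (hm _)),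
        lintegral_law_succ _ _ _
          (F := fun h => ∫⁻ w, F ((h (Fin.last n)).1, w) ∂(P : Measure (Weights L)))
          (hF.lintegral_prod_right'.comp (hm _).fst)]
      refine lintegral_congr fun h => ?_
      simp only [Fin.snoc_last]
      rw [lintegral_step _ _ _ _ hF,
        lintegral_step _ _ _ _
          (F := fun r => ∫⁻ w, F (r.1, w) ∂(P : Measure (Weights L))) (hF.lintegral_prod_right'.comp measurable_fst)]
      simp
    · have h1 : (π.law P (n + 1)).map (fun h => h s.castSucc) =
          (π.law P n).map fun h => h s := by
        refine Measure.ext_of_lintegral _ fun F hF => ?_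
        rw [lintegral_map hF (hm _), lintegral_map hF (hm _),
          lintegral_law_succ _ _ _ (F := fun h => F (h s.castSucc)) (hF.comp (hm _))]
        simp
      have h2 : ∀ {m : ℕ} (s : Fin m), (π.law P m).map (fun h => (h s).1) =
          ((π.law P m).map fun h => h s).map Prod.fst := fun s => by
        rw [Measure.map_map measurable_fst (hm s)]; rfl
      rw [h2, h1, ← h2, ih s]

end Policy

end SemiBandit

namespace SemiBandit

/-! ### Visit counts and the information inequality. -/

namespace Policy

variable {L : ℕ} {Θ : Finset (Finset (Fin L))} (π : Policy Θ)

/-- The number of times that `A` is chosen in the history `h`. -/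
def visits {n : ℕ} (A : Finset (Fin L)) (h : Fin n → Round Θ) : ℝ :=
  ((Finset.univ.filter fun t => (h t).1.1 = A).card : ℝ)

theorem visits_eq_sum {n : ℕ} (A : Finset (Fin L)) (h : Fin n → Round Θ) :
    visits A h = ∑ t, if (h t).1.1 = A then (1 : ℝ) else 0 := by
  simp [visits]

theorem visits_nonneg {n : ℕ} (A : Finset (Fin L)) (h : Fin n → Round Θ) : 0 ≤ visits A h :=
  Nat.cast_nonneg _

theorem visits_le {n : ℕ} (A : Finset (Fin L)) (h : Fin n → Round Θ) : visits A h ≤ n := by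
  unfold visits
  exact_mod_cast (Finset.card_le_univ _).trans (by simp)

theorem measurable_visits {n : ℕ} (A : Finset (Fin L)) :
    Measurable (visits A : (Fin n → Round Θ) → ℝ) := by
  have : (visits A : (Fin n → Round Θ) → ℝ) =
      fun h => ∑ t, if (h t).1.1 = A then (1 : ℝ) else 0 := funext (visits_eq_sum A)
  rw [this]
  refine Finset.measurable_sum _ fun t _ => ?_
  have : Measurable fun B : Θ => if B.1 = A then (1 : ℝ) else 0 := measurable_of_countable _
  exact this.comp (measurable_pi_apply t).fst

theorem integrable_visits (P : ProbabilityMeasure (Weights L)) (n : ℕ) (A : Finset (Fin L)) :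
    Integrable (visits A) (π.law P n) :=
  Integrable.of_bound (measurable_visits A).aestronglyMeasurable n
    (.of_forall fun h => by
      rw [Real.norm_of_nonneg (visits_nonneg A h)]; exact visits_le A h)

theorem sum_comp_fst {n : ℕ} (f : Θ → ℝ) (h : Fin n → Round Θ) :
    ∑ t, f (h t).1 = ∑ A : Θ, f A * visits A.1 h := by
  simp only [visits_eq_sum, Finset.mul_sum]
  rw [Finset.sum_comm]
  refine Finset.sum_congr rfl fun t _ => ?_
  simp

theorem sum_visits {n : ℕ} (h : Fin n → Round Θ) : ∑ A : Θ, visits A.1 h = n := by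
  simpa using (sum_comp_fst (fun _ => 1) h).symm

theorem integrable_comp_apply (P : ProbabilityMeasure (Weights L)) (n : ℕ) (t : Fin n)
    {φ : Round Θ → ℝ} (hφ : Measurable φ) {C : ℝ} (hC : ∀ r, |φ r| ≤ C) :
    Integrable (fun h => φ (h t)) (π.law P n) :=
  Integrable.of_bound (hφ.comp (measurable_pi_apply t)).aestronglyMeasurable C
    (.of_forall fun _ => hC _)

theorem integral_comp_apply (P : ProbabilityMeasure (Weights L)) (n : ℕ) (t : Fin n)
    {φ : Round Θ → ℝ} (hφ : Measurable φ) {C : ℝ} (hC : ∀ r, |φ r| ≤ C) :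
    ∫ h, φ (h t) ∂(π.law P n) =
      ∫ h, ∫ w, φ ((h t).1, w) ∂(P : Measure (Weights L)) ∂(π.law P n) := by
  have hm : Measurable fun h : Fin n → Round Θ => h t := measurable_pi_apply t
  have : IsProbabilityMeasure ((π.law P n).map fun h => (h t).1) :=
    Measure.isProbabilityMeasure_map hm.fst.aemeasurable
  rw [← integral_map hm.aemeasurable hφ.aestronglyMeasurable, map_law_apply,
    integral_prod _ (Integrable.of_bound hφ.aestronglyMeasurable C (.of_forall hC)),
    integral_map hm.fst.aemeasurable (measurable_of_countable _).aestronglyMeasurable]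

/-- A Wald identity, valid because the weights of a round are independent of its chosen solution. It
serves both the information bound and the regret decomposition. -/
theorem integral_sum_comp (P : ProbabilityMeasure (Weights L)) (n : ℕ)
    {φ : Round Θ → ℝ} (hφ : Measurable φ) {C : ℝ} (hC : ∀ r, |φ r| ≤ C) :
    ∫ h, ∑ t, φ (h t) ∂(π.law P n) =
      ∑ A : Θ, (∫ w, φ (A, w) ∂(P : Measure (Weights L))) * ∫ h, visits A.1 h ∂(π.law P n) := by
  rw [integral_finsetSum _ fun t _ => π.integrable_comp_apply P n t hφ hC]
  simp only [π.integral_comp_apply P n _ hφ hC]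
  rw [← integral_finsetSum]
  · simp only [sum_comp_fst (fun A => ∫ w, φ (A, w) ∂(P : Measure (Weights L)))]
    rw [integral_finsetSum _ fun A _ => (π.integrable_visits P n A.1).const_mul _]
    simp only [integral_const_mul]
  · intro t _
    let ψ : Round Θ → ℝ := fun r => ∫ w, φ (r.1, w) ∂(P : Measure (Weights L))
    have hψ : Measurable ψ :=
      (measurable_of_countable fun A => ∫ w, φ (A, w) ∂(P : Measure (Weights L))).comp
        measurable_fst
    refine π.integrable_comp_apply P n t hψ (C := C) fun r => ?_
    simpa using norm_integral_le_of_norm_le_const (μ := (P : Measure (Weights L)))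
      (f := fun w => φ (r.1, w)) (.of_forall fun w => hC (r.1, w))

theorem historyRatio_pos {n : ℕ} (a : Θ) {ρ : Weights L → ℝ} (hρ : ∀ w, 0 < ρ w)
    (h : Fin n → Round Θ) : 0 < ∏ i, roundRatio a ρ (h i) :=
  Finset.prod_pos fun i _ => by unfold roundRatio; split_ifs <;> simp [hρ]

theorem integral_law_comp_fst {P P' : ProbabilityMeasure (Weights L)} {a : Θ}
    {ρ : Weights L → ℝ} (hρ : Measurable ρ) (hpos : ∀ w, 0 < ρ w) (hr : IsRatio P P' a ρ)
    (n : ℕ) {F : (Fin n → Round Θ) → ℝ} (hF : Measurable F) (hF0 : ∀ h, 0 ≤ F h)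
    (hobs : ∀ h, F (fun i => observe (h i)) = F h) :
    ∫ h, F h ∂(π.law P' n) = ∫ h, F h * ∏ i, roundRatio a ρ (h i) ∂(π.law P n) := by
  have hZ : Measurable fun h : Fin n → Round Θ => ∏ i, roundRatio a ρ (h i) :=
    Finset.measurable_prod _ fun i _ =>
      (measurable_roundRatio a hρ).comp (measurable_pi_apply i)
  rw [integral_eq_lintegral_of_nonneg_ae (.of_forall hF0) hF.aestronglyMeasurable,
    integral_eq_lintegral_of_nonneg_ae
      (.of_forall fun h => mul_nonneg (hF0 h) (historyRatio_pos a hpos h).le)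
      (hF.mul hZ).aestronglyMeasurable]
  have := π.lintegral_law_observe hρ hr n hF.ennreal_ofReal
  simp only [hobs] at this
  rw [this]
  congr 1
  refine lintegral_congr fun h => ?_
  rw [ENNReal.ofReal_mul (hF0 h), ENNReal.ofReal_prod_of_nonneg]
  intro i _
  unfold roundRatio; split_ifs <;> simp [(hpos _).le]

/-- The chord of `exp` over `0` and `s`, with the term `-x` dropped. It makes the bound linear in
`x`, so that only the expectation of `x` under `P'` is needed. -/
theorem exp_mul_le_one_add {s x : ℝ} (hx0 : 0 ≤ x) (hx1 : x ≤ 1) :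
    Real.exp (s * x) ≤ 1 + x * Real.exp s := by
  have := convexOn_exp.2 (Set.mem_univ 0) (Set.mem_univ s) (sub_nonneg.2 hx1) hx0 (by ring)
  simp only [smul_eq_mul, mul_zero, zero_add, Real.exp_zero, mul_one] at this
  rw [mul_comm s x]
  linarith

/-- With `Z` the product of the ratios, `log u ≤ u - 1` is used at `u = exp (s * x) * Z` and at the
inverse ratio of each round; the terms `log Z` cancel in the sum. This is a pointwise
Donsker-Varadhan inequality with chi-square in place of relative entropy. -/
theorem le_sum_inv_ratio {n : ℕ} (a : Θ) {ρ : Weights L → ℝ} (hρ : ∀ w, 0 < ρ w) {s x : ℝ}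
    (hx0 : 0 ≤ x) (hx1 : x ≤ 1) (h : Fin n → Round Θ) :
    s * x + 1 - (1 + x * Real.exp s) * ∏ i, roundRatio a ρ (h i) ≤
      ∑ i, ((roundRatio a ρ (h i))⁻¹ - 1) := by
  have hpos : ∀ i, 0 < roundRatio a ρ (h i) := fun i => by
    unfold roundRatio; split_ifs <;> simp [hρ]
  have hZ := historyRatio_pos a hρ h
  have h1 : Real.log (∏ i, roundRatio a ρ (h i))⁻¹ ≤ ∑ i, ((roundRatio a ρ (h i))⁻¹ - 1) := by
    rw [Real.log_inv, Real.log_prod fun i _ => (hpos i).ne', ← Finset.sum_neg_distrib]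
    refine Finset.sum_le_sum fun i _ => ?_
    rw [← Real.log_inv]
    exact Real.log_le_sub_one_of_pos (inv_pos.2 (hpos i))
  have h2 := Real.log_le_sub_one_of_pos (mul_pos (Real.exp_pos (s * x)) hZ)
  rw [Real.log_mul (Real.exp_pos _).ne' hZ.ne', Real.log_exp] at h2
  rw [Real.log_inv] at h1
  have h3 := mul_le_mul_of_nonneg_right (exp_mul_le_one_add (s := s) hx0 hx1) hZ.le
  linarith

/-- The information inequality: under `P`, the solution `a` has to be visited often enough to
be told apart from the alternative `P'`, under which the other solutions are rarely visited. -/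
theorem information_le {P P' : ProbabilityMeasure (Weights L)} {a : Θ}
    {ρ : Weights L → ℝ} (hρ : Measurable ρ) {c C : ℝ} (hc : 0 < c) (hcρ : ∀ w, c ≤ ρ w)
    (hρC : ∀ w, ρ w ≤ C) (hr : IsRatio P P' a ρ) {n : ℕ} (hn : 0 < n) (s : ℝ) :
    s * (1 - (∫ h, visits a.1 h ∂(π.law P n)) / n) ≤
      (∫ w, ((ρ w)⁻¹ - 1) ∂(P : Measure (Weights L))) * (∫ h, visits a.1 h ∂(π.law P n)) +
        Real.exp s * (1 - (∫ h, visits a.1 h ∂(π.law P' n)) / n) := by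
  have hn' : (0 : ℝ) < n := Nat.cast_pos.2 hn
  have hpos : ∀ w, 0 < ρ w := fun w => hc.trans_le (hcρ w)
  -- The fraction of rounds not spent on `a`: near `1` in mean under `P` if `a` is rare, near `0`
  -- under `P'` if `a` dominates.
  let x : (Fin n → Round Θ) → ℝ := fun h => 1 - visits a.1 h / n
  have hx0 : ∀ h, 0 ≤ x h := fun h => sub_nonneg.2 ((div_le_one hn').2 (visits_le _ h))
  have hx1 : ∀ h, x h ≤ 1 := fun h => by
    have := div_nonneg (visits_nonneg a.1 h) hn'.le
    simp only [x]; linarith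
  have hxm : Measurable x := measurable_const.sub ((measurable_visits _).div_const _)
  have hxi : ∀ Q, Integrable x (π.law Q n) := fun Q =>
    (integrable_const 1).sub ((π.integrable_visits Q n _).div_const _)
  have hxE : ∀ Q, ∫ h, x h ∂(π.law Q n) = 1 - (∫ h, visits a.1 h ∂(π.law Q n)) / n := fun Q => by
    simp only [x]
    rw [integral_sub (integrable_const 1) ((π.integrable_visits Q n _).div_const _),
      integral_div]
    simp
  let Z : (Fin n → Round Θ) → ℝ := fun h => ∏ i, roundRatio a ρ (h i)
  have hZm : Measurable Z := Finset.measurable_prod _ fun i _ =>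
      (measurable_roundRatio a hρ).comp (measurable_pi_apply i)
  have hrr : ∀ r : Round Θ, 0 < roundRatio a ρ r ∧ roundRatio a ρ r ≤ max C 1 := fun r => by
    unfold roundRatio; split_ifs <;> simp [hpos, hρC]
  have hZb : ∀ h, Z h ≤ max C 1 ^ n := fun h => by
    simpa using Finset.prod_le_prod (s := Finset.univ) (fun i _ => (hrr (h i)).1.le)
      fun i _ => (hrr (h i)).2
  have hZi : Integrable Z (π.law P n) := Integrable.of_bound hZm.aestronglyMeasurable _
    (.of_forall fun h => by
      rw [Real.norm_of_nonneg (historyRatio_pos a hpos h).le]; exact hZb h)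
  have hE : 0 < Real.exp s := Real.exp_pos s
  have hFZi : Integrable (fun h => (1 + x h * Real.exp s) * Z h) (π.law P n) := by
    refine hZi.bdd_mul (c := 1 + Real.exp s)
      (measurable_const.add (hxm.mul_const _)).aestronglyMeasurable (.of_forall fun h => ?_)
    rw [Real.norm_of_nonneg (add_nonneg zero_le_one (mul_nonneg (hx0 h) hE.le))]
    have := mul_le_mul_of_nonneg_right (hx1 h) hE.le
    linarith
  have hobs : ∀ h : Fin n → Round Θ, x (fun i => observe (h i)) = x h := fun h => rfl
  -- The product with `Z` has an expectation under `P` that is an expectation under `P'`, as `x`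
  -- depends only on the chosen solutions.
  have hchange : 1 + (∫ h, x h ∂(π.law P' n)) * Real.exp s =
      ∫ h, (1 + x h * Real.exp s) * Z h ∂(π.law P n) := by
    rw [← π.integral_law_comp_fst hρ hpos hr n (F := fun h => 1 + x h * Real.exp s)
      (measurable_const.add (hxm.mul_const _))
      (fun h => add_nonneg zero_le_one (mul_nonneg (hx0 h) hE.le)) fun h => by rw [hobs],
      integral_add (integrable_const _) ((hxi P').mul_const _), integral_mul_const]
    simp
  have hinvm : Measurable fun r : Round Θ => (roundRatio a ρ r)⁻¹ - 1 :=
    (measurable_roundRatio a hρ).inv.sub_const 1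
  have hinvb : ∀ r : Round Θ, |(roundRatio a ρ r)⁻¹ - 1| ≤ c⁻¹ + 1 := fun r => by
    have h1 : 0 < (roundRatio a ρ r)⁻¹ := inv_pos.2 (hrr r).1
    have h2 : (roundRatio a ρ r)⁻¹ ≤ c⁻¹ + 1 := by
      unfold roundRatio
      split_ifs
      · have := inv_anti₀ hc (hcρ r.2); linarith
      · have := inv_pos.2 hc; simp [this.le]
    have := inv_pos.2 hc
    rw [abs_le]; constructor <;> linarith
  have hsum := π.integral_sum_comp P n hinvm hinvb
  have hmain : ∫ h, (s * x h + 1 - (1 + x h * Real.exp s) * Z h) ∂(π.law P n) ≤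
      ∫ h, ∑ i, ((roundRatio a ρ (h i))⁻¹ - 1) ∂(π.law P n) :=
    integral_mono ((((hxi P).const_mul s).add (integrable_const 1)).sub hFZi)
      (integrable_finsetSum _ fun i _ => π.integrable_comp_apply P n i hinvm hinvb)
      fun h => le_sum_inv_ratio a hpos (hx0 h) (hx1 h) h
  rw [hsum, integral_sub (f := fun h => s * x h + 1)
      (((hxi P).const_mul s).add (integrable_const 1)) hFZi,
    integral_add ((hxi P).const_mul s) (integrable_const 1), integral_const_mul, ← hchange,
    hxE, hxE, Finset.sum_eq_single a] at hmain
  · simp only [roundRatio, if_true, integral_const, probReal_univ, smul_eq_mul, mul_one] at hmain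
    linarith
  -- Rounds with another solution have ratio `1` and carry no information.
  · intro b _ hb
    simp [roundRatio, hb]
  · simp

end Policy

end SemiBandit

noncomputable section

namespace SemiBandit

theorem lintegral_bernoulliMeasure_one_zero (p : unitInterval) (g : unitInterval → ℝ≥0∞) :
    ∫⁻ y, g y ∂(bernoulliMeasure 1 0 p) =
      ENNReal.ofReal p * g 1 + ENNReal.ofReal (1 - p) * g 0 := by
  have h : ∀ q : unitInterval, (unitInterval.toNNReal q : ℝ≥0∞) = ENNReal.ofReal q := fun q => by
    rw [ENNReal.ofReal, ENNReal.coe_inj]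
    ext
    simp [q.2.1]
  rw [bernoulliMeasure_def, lintegral_add_measure]
  simp only [lintegral_smul_measure, lintegral_dirac, ENNReal.smul_def, smul_eq_mul, h]
  simp

/-! ### Laws of path weights and combinatorics of paths. -/

section PathLaw

variable {L K : ℕ}

/-- The distribution of the weights when the items of path `j` have mean `μ j`. -/
def pathLawOf (hdvd : K ∣ L) (μ : Fin (L / K) → unitInterval) : Measure (Weights L) :=
  (Measure.pi fun j => (bernoulliMeasure 1 0 (μ j) : Measure unitInterval)).map
    fun x e => x (pathIndex hdvd e)

theorem measurable_pathExtend (hdvd : K ∣ L) :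
    Measurable fun (x : Fin (L / K) → unitInterval) e => x (pathIndex hdvd e) :=
  measurable_pi_lambda _ fun _ => measurable_pi_apply _

instance isProbabilityMeasure_pathLawOf (hdvd : K ∣ L) (μ : Fin (L / K) → unitInterval) :
    IsProbabilityMeasure (pathLawOf hdvd μ) :=
  Measure.isProbabilityMeasure_map (measurable_pathExtend hdvd).aemeasurable

theorem lintegral_pathLawOf (hdvd : K ∣ L) (μ : Fin (L / K) → unitInterval) (i : Fin (L / K))
    {G : Weights L → ℝ≥0∞} (hG : Measurable G) {g : unitInterval → ℝ≥0∞} (hg : Measurable g)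
    (h : ∀ x : Fin (L / K) → unitInterval, G (fun e => x (pathIndex hdvd e)) = g (x i)) :
    ∫⁻ w, G w ∂(pathLawOf hdvd μ) =
      ENNReal.ofReal (μ i) * g 1 + ENNReal.ofReal (1 - μ i) * g 0 := by
  have hev := measurePreserving_eval
    (fun j => (bernoulliMeasure 1 0 (μ j) : Measure unitInterval)) i
  rw [pathLawOf, lintegral_map hG (measurable_pathExtend hdvd),
    ← lintegral_bernoulliMeasure_one_zero, ← hev.lintegral_comp hg]
  exact lintegral_congr h

theorem map_eval_pathLawOf (hdvd : K ∣ L) (μ : Fin (L / K) → unitInterval) (e : Fin L) :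
    (pathLawOf hdvd μ).map (fun w => w e) = bernoulliMeasure 1 0 (μ (pathIndex hdvd e)) := by
  rw [pathLawOf, Measure.map_map (measurable_pi_apply e) (measurable_pathExtend hdvd)]
  exact (measurePreserving_eval
    (fun j => (bernoulliMeasure 1 0 (μ j) : Measure unitInterval)) (pathIndex hdvd e)).map_eq

theorem integral_eval_pathLawOf (hdvd : K ∣ L) (μ : Fin (L / K) → unitInterval) (e : Fin L)
    {f : unitInterval → ℝ} (hf : Measurable f) :
    ∫ w, f (w e) ∂(pathLawOf hdvd μ) =
      μ (pathIndex hdvd e) * f 1 + (1 - μ (pathIndex hdvd e)) * f 0 := by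
  rw [← integral_map (φ := fun w : Weights L => w e) (measurable_pi_apply e).aemeasurable
      hf.aestronglyMeasurable, map_eval_pathLawOf, integral_bernoulliMeasure]
  simp

theorem mem_path (hdvd : K ∣ L) {i : Fin (L / K)} {e : Fin L} :
    e ∈ path L K i ↔ pathIndex hdvd e = i := by
  simp [path, pathIndex, Fin.ext_iff]

/-- The first item of path `j`. -/
def firstItem (hdvd : K ∣ L) (hL : 0 < L) (j : Fin (L / K)) : Fin L :=
  ⟨j * K, (Nat.mul_lt_mul_of_pos_right j.2 (Nat.pos_of_dvd_of_pos hdvd hL)).trans_le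
    (Nat.div_mul_le_self L K)⟩

theorem pathIndex_firstItem (hdvd : K ∣ L) (hL : 0 < L) (j : Fin (L / K)) :
    pathIndex hdvd (firstItem hdvd hL j) = j := by
  ext
  exact Nat.mul_div_cancel _ (Nat.pos_of_dvd_of_pos hdvd hL)

theorem card_path (hdvd : K ∣ L) (hL : 0 < L) (j : Fin (L / K)) : (path L K j).card = K := by
  have hK := Nat.pos_of_dvd_of_pos hdvd hL
  have hlt : ∀ r < K, j * K + r < L := fun r hr => by
    have h1 : (j + 1 : ℕ) * K ≤ L / K * K := Nat.mul_le_mul_right _ j.2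
    have h2 := Nat.div_mul_le_self L K
    rw [add_mul, one_mul] at h1
    omega
  refine Eq.trans (Eq.symm ?_) (Finset.card_range K)
  refine Finset.card_bij (fun r hr => ⟨j * K + r, hlt r (Finset.mem_range.1 hr)⟩) ?_ ?_ ?_
  · intro r hr
    have hr := Finset.mem_range.1 hr
    simp only [path, Finset.mem_filter, Finset.mem_univ, true_and]
    rw [mul_comm, Nat.mul_add_div hK, Nat.div_eq_of_lt hr, add_zero]
  · intro r _ r' _ h
    simpa using h
  · intro e he
    simp only [path, Finset.mem_filter, Finset.mem_univ, true_and] at he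
    refine ⟨e % K, Finset.mem_range.2 (Nat.mod_lt _ hK), Fin.ext ?_⟩
    simp only [← he]
    exact Nat.div_add_mod' _ _

theorem path_injective (hdvd : K ∣ L) (hL : 0 < L) :
    Function.Injective fun j : Fin (L / K) => path L K j := by
  intro i j h
  have : firstItem hdvd hL i ∈ path L K j := by
    simp only at h
    rw [← h]; exact (mem_path hdvd).2 (pathIndex_firstItem hdvd hL i)
  rw [mem_path hdvd, pathIndex_firstItem] at this
  exact this

end PathLaw

/-! ### Path semi-bandits with arbitrary means, and their likelihood ratios. -/

section PathBandit

variable {L K : ℕ} (hL : 0 < L) (hdvd : K ∣ L)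

/-- The path semi-bandit in which the items of path `j` have mean `μ j`. -/
def pathBandit (μ : Fin (L / K) → unitInterval) : Bandit L where
  Θ := (Finset.range (L / K)).image (path L K)
  nonempty := by
    have : 0 < L / K := Nat.div_pos (Nat.le_of_dvd hL hdvd) (Nat.pos_of_dvd_of_pos hdvd hL)
    exact ⟨_, Finset.mem_image_of_mem _ (Finset.mem_range.2 this)⟩
  P := ⟨pathLawOf hdvd μ, inferInstance⟩

theorem kPath_eq_pathBandit (Δ : ℝ) (h0 : 0 < Δ / K) (h1 : Δ / K < 1 / 2) :
    kPath hL hdvd Δ h0 h1 = pathBandit hL hdvd fun j => pathMean K Δ h0 h1 j := rfl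

variable (μ : Fin (L / K) → unitInterval)

theorem mem_pathBandit {A : Finset (Fin L)} :
    A ∈ (pathBandit hL hdvd μ).Θ ↔ ∃ j : Fin (L / K), path L K j = A := by
  simp [pathBandit, Fin.exists_iff]

theorem sum_pathBandit {M : Type*} [AddCommMonoid M] (F : Finset (Fin L) → M) :
    ∑ A : (pathBandit hL hdvd μ).Θ, F A.1 = ∑ j : Fin (L / K), F (path L K j) := by
  rw [Finset.sum_coe_sort (pathBandit hL hdvd μ).Θ F, pathBandit,
    Finset.sum_image, Finset.sum_range]
  intro i hi j hj h
  exact congrArg Fin.val (@path_injective L K hdvd hL ⟨i, by simpa using hi⟩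
    ⟨j, by simpa using hj⟩ h)

theorem mean_pathBandit (e : Fin L) :
    (pathBandit hL hdvd μ).mean e = μ (pathIndex hdvd e) := by
  have := integral_eval_pathLawOf hdvd μ e (f := fun y => (y : ℝ)) measurable_subtype_coe
  simpa [Bandit.mean, pathBandit] using this

theorem ret_path_mean (j : Fin (L / K)) :
    ret (path L K j) (pathBandit hL hdvd μ).mean = K * μ j := by
  have : ∀ e ∈ path L K j, (pathBandit hL hdvd μ).mean e = μ j := fun e he => by
    rw [mean_pathBandit, (mem_path hdvd).1 he]
  rw [ret, Finset.sum_congr rfl this, Finset.sum_const, card_path hdvd hL, nsmul_eq_mul]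

theorem isOptimal_path_iff (i : Fin (L / K)) :
    (pathBandit hL hdvd μ).IsOptimal (path L K i) ↔ ∀ j, μ j ≤ μ i := by
  have hK : (0 : ℝ) < K := Nat.cast_pos.2 (Nat.pos_of_dvd_of_pos hdvd hL)
  constructor
  · intro h j
    have := h.2 _ ((mem_pathBandit hL hdvd μ).2 ⟨j, rfl⟩)
    rw [ret_path_mean, ret_path_mean] at this
    exact Subtype.coe_le_coe.1 (le_of_mul_le_mul_left this hK)
  · intro h
    refine ⟨(mem_pathBandit hL hdvd μ).2 ⟨i, rfl⟩, fun A hA => ?_⟩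
    obtain ⟨j, rfl⟩ := (mem_pathBandit hL hdvd μ).1 hA
    rw [ret_path_mean, ret_path_mean]
    exact mul_le_mul_of_nonneg_left (h j) hK.le

theorem hasUniqueOptimum_pathBandit {j : Fin (L / K)} (hj : ∀ i, i ≠ j → μ i < μ j) :
    (pathBandit hL hdvd μ).HasUniqueOptimum := by
  refine ⟨path L K j, (isOptimal_path_iff hL hdvd μ j).2 fun i => ?_, fun A hA => ?_⟩
  · rcases eq_or_ne i j with rfl | h
    exacts [le_rfl, (hj i h).le]
  · obtain ⟨i, rfl⟩ := (mem_pathBandit hL hdvd μ).1 hA.1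
    by_contra hne
    have hij : i ≠ j := fun h => hne (h ▸ rfl)
    exact ((isOptimal_path_iff hL hdvd μ i).1 hA j).not_gt (hj i hij)

/-- The density of the Bernoulli law of mean `q'` with respect to that of mean `q`. -/
def bernoulliRatio (q q' : ℝ) (y : unitInterval) : ℝ :=
  y * (q' / q) + (1 - y) * ((1 - q') / (1 - q))

theorem measurable_bernoulliRatio (q q' : ℝ) : Measurable (bernoulliRatio q q') := by
  unfold bernoulliRatio
  fun_prop

/-- The affine extension of the ratio from `{0, 1}` to `[0, 1]` is a convex combination of its end
values, so the bounds hold at every point and not just almost surely. -/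
theorem le_bernoulliRatio (q q' : ℝ) (y : unitInterval) :
    min (q' / q) ((1 - q') / (1 - q)) ≤ bernoulliRatio q q' y := by
  have h1 := mul_le_mul_of_nonneg_left (min_le_left (q' / q) ((1 - q') / (1 - q))) y.2.1
  have h2 := mul_le_mul_of_nonneg_left (min_le_right (q' / q) ((1 - q') / (1 - q)))
    (sub_nonneg.2 y.2.2)
  unfold bernoulliRatio
  linarith

theorem bernoulliRatio_le (q q' : ℝ) (y : unitInterval) :
    bernoulliRatio q q' y ≤ max (q' / q) ((1 - q') / (1 - q)) := by
  have h1 := mul_le_mul_of_nonneg_left (le_max_left (q' / q) ((1 - q') / (1 - q))) y.2.1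
  have h2 := mul_le_mul_of_nonneg_left (le_max_right (q' / q) ((1 - q') / (1 - q)))
    (sub_nonneg.2 y.2.2)
  unfold bernoulliRatio
  linarith

/-- Choosing path `i` reveals only the Bernoulli variable of path `i`, and its law changes only for
`i = j`. The first item of path `j` stands for the whole path. -/
theorem isRatio_pathBandit (j : Fin (L / K)) (q' : unitInterval) (h0 : 0 < (μ j : ℝ))
    (h1 : (μ j : ℝ) < 1) (a : (pathBandit hL hdvd μ).Θ) (ha : a.1 = path L K j) :
    Policy.IsRatio (pathBandit hL hdvd μ).P (pathBandit hL hdvd (Function.update μ j q')).P a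
      fun w => bernoulliRatio (μ j) q' (w (firstItem hdvd hL j)) := by
  intro A g hg
  obtain ⟨i, hi⟩ := (mem_pathBandit hL hdvd μ).1 A.2
  let ext : unitInterval → Weights L := fun y e => if e ∈ A.1 then y else 0
  have hext : Measurable ext := measurable_pi_lambda _ fun e => by
    by_cases h : e ∈ A.1
    · simpa [ext, h] using measurable_id'
    · simp [ext, h]
  have hobs : ∀ x : Fin (L / K) → unitInterval,
      observe (A, fun e => x (pathIndex hdvd e)) = (A, ext (x i)) := fun x => by
    simp only [observe, ext]
    congr 1
    funext e
    split_ifs with h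
    · rw [← hi, mem_path hdvd] at h
      rw [h]
    · rfl
  have hgo : Measurable fun w : Weights L => g (observe (A, w)) :=
    hg.comp (measurable_observe.comp (measurable_const.prodMk measurable_id))
  have hge : Measurable fun y => g (A, ext y) := hg.comp (measurable_const.prodMk hext)
  have hfirst : Measurable fun w : Weights L => w (firstItem hdvd hL j) := measurable_pi_apply _
  have hρ := (measurable_bernoulliRatio (μ j) q').ennreal_ofReal
  change ∫⁻ w, g (observe (A, w)) ∂(pathLawOf hdvd (Function.update μ j q')) =
    ∫⁻ w, _ ∂(pathLawOf hdvd μ)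
  rw [lintegral_pathLawOf hdvd _ i hgo hge fun x => by rw [hobs]]
  by_cases hij : i = j
  · subst hij
    have hAa : A = a := Subtype.ext (hi.symm.trans ha.symm)
    simp only [Policy.roundRatio, hAa, if_true]
    subst hAa
    rw [lintegral_pathLawOf hdvd _ i (G := fun w => g (observe (A, w)) *
        ENNReal.ofReal (bernoulliRatio (μ i) q' (w (firstItem hdvd hL i))))
      (hgo.mul (hρ.comp hfirst)) (hge.mul hρ) fun x => by
        simp only [Pi.mul_apply, hobs, pathIndex_firstItem]]
    have e1 : ENNReal.ofReal (μ i) * ENNReal.ofReal (bernoulliRatio (μ i) q' 1) =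
        ENNReal.ofReal q' := by
      rw [← ENNReal.ofReal_mul h0.le]
      congr 1
      simp only [bernoulliRatio, Set.Icc.coe_one]
      field_simp
      ring
    have e2 : ENNReal.ofReal (1 - μ i) * ENNReal.ofReal (bernoulliRatio (μ i) q' 0) =
        ENNReal.ofReal (1 - q') := by
      rw [← ENNReal.ofReal_mul (sub_nonneg.2 h1.le)]
      congr 1
      have := (sub_pos.2 h1).ne'
      simp only [bernoulliRatio, Set.Icc.coe_zero]
      field_simp
      ring
    simp only [Function.update_self, Pi.mul_apply]
    rw [← e1, ← e2]
    ring
  · have hAa : A ≠ a := fun h => hij (path_injective hdvd hL (by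
      simp only [hi, h, ha]))
    simp only [Policy.roundRatio, hAa, if_false, ENNReal.ofReal_one, mul_one]
    rw [lintegral_pathLawOf hdvd _ i hgo hge fun x => by rw [hobs], Function.update_of_ne hij]

/-- The chi-square divergence of Bernoulli(`μ j`) from Bernoulli(`q'`): the information cost of one
visit to path `j`. -/
theorem integral_inv_bernoulliRatio (j : Fin (L / K)) {q' : ℝ}
    (h1 : (μ j : ℝ) < 1) (h0' : 0 < q') (h1' : q' < 1) :
    ∫ w, ((bernoulliRatio (μ j) q' (w (firstItem hdvd hL j)))⁻¹ - 1)
        ∂((pathBandit hL hdvd μ).P : Measure (Weights L)) =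
      (μ j - q') ^ 2 / (q' * (1 - q')) := by
  have := integral_eval_pathLawOf hdvd μ (firstItem hdvd hL j)
    (f := fun y => (bernoulliRatio (μ j) q' y)⁻¹ - 1)
    ((measurable_bernoulliRatio _ _).inv.sub_const 1)
  rw [pathIndex_firstItem] at this
  refine this.trans ?_
  have e1 := (sub_pos.2 h1).ne'
  have e2 := (sub_pos.2 h1').ne'
  have r1 : bernoulliRatio (μ j) q' 1 = q' / μ j := by simp [bernoulliRatio]
  have r0 : bernoulliRatio (μ j) q' 0 = (1 - q') / (1 - μ j) := by simp [bernoulliRatio]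
  rw [r1, r0]
  field_simp
  ring

end PathBandit

end SemiBandit

end

namespace SemiBandit

/-! ### From the information inequality to logarithmically many visits. -/

theorem eventually_mul_log_le {T δ : ℕ → ℝ} {κ α y : ℝ} (hα : α ≤ 1) (hκ : 0 ≤ κ)
    (hyκ : y * κ < 1 - α) (hδ : Tendsto δ atTop (𝓝 0))
    (h : ∀ᶠ n : ℕ in atTop, (1 - α) * Real.log n * (1 - T n / n) ≤ κ * T n + δ n) :
    ∀ᶠ n : ℕ in atTop, y * Real.log n ≤ T n := by
  have hu : Tendsto (fun n : ℕ => y * (1 - α) * (Real.log n / n)) atTop (𝓝 0) := by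
    simpa using (Real.isLittleO_log_id_atTop.tendsto_div_nhds_zero.comp
      tendsto_natCast_atTop_atTop).const_mul (y * (1 - α))
  have hl : ∀ᶠ n : ℕ in atTop, 1 ≤ Real.log n :=
    (Real.tendsto_log_atTop.comp tendsto_natCast_atTop_atTop).eventually_ge_atTop 1
  -- Half of the slack, in units of `log n`, absorbs the term with `T n / n`; the other half absorbs
  -- `δ n`, since `log n ≥ 1`.
  have hg : 0 < (1 - α - y * κ) / 2 := by linarith
  filter_upwards [h, hu.eventually (gt_mem_nhds hg), hδ.eventually (gt_mem_nhds hg), hl]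
    with n h1 h2 h3 h4
  by_contra! h5
  have hl0 : 0 ≤ Real.log n := by linarith
  have e1 := mul_le_mul_of_nonneg_left h5.le hκ
  have e2 : (1 - α) * Real.log n * (T n / n) ≤ (1 - α) * Real.log n * (y * Real.log n / n) :=
    mul_le_mul_of_nonneg_left (div_le_div_of_nonneg_right h5.le (Nat.cast_nonneg n))
      (mul_nonneg (by linarith) hl0)
  have e3 : (1 - α) * Real.log n * (y * Real.log n / n) =
      y * (1 - α) * (Real.log n / n) * Real.log n := by ring
  have e4 := mul_lt_mul_of_pos_right h2 (by linarith : 0 < Real.log n)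
  have e5 := mul_le_mul_of_nonneg_left h4 hg.le
  nlinarith

/-- At `ε = 0` the divergence is exactly `4 * d ^ 2`; continuity leaves room for a strictly positive
`ε`, which makes the alternative optimum unique. -/
theorem exists_alternative_gap {d y : ℝ} (hd : 0 < d) (hy : y < 1 / (4 * d ^ 2)) :
    ∃ ε : ℝ, 0 < ε ∧ ε < 1 / 2 ∧
      y * ((1 / 2 - d - (1 / 2 + ε)) ^ 2 / ((1 / 2 + ε) * (1 - (1 / 2 + ε)))) < 1 := by
  have hc : ContinuousAt (fun ε : ℝ =>
      y * ((1 / 2 - d - (1 / 2 + ε)) ^ 2 / ((1 / 2 + ε) * (1 - (1 / 2 + ε))))) 0 := by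
    refine continuousAt_const.mul (ContinuousAt.div ?_ ?_ (by norm_num)) <;> fun_prop
  have h0 : (fun ε : ℝ =>
      y * ((1 / 2 - d - (1 / 2 + ε)) ^ 2 / ((1 / 2 + ε) * (1 - (1 / 2 + ε))))) 0 < 1 := by
    rw [lt_div_iff₀ (by positivity)] at hy
    have : y * ((1 / 2 - d - (1 / 2 + 0)) ^ 2 / ((1 / 2 + 0) * (1 - (1 / 2 + 0)))) =
      y * (4 * d ^ 2) := by ring
    simpa only [this] using hy
  have h1 := (hc.eventually (gt_mem_nhds h0)).filter_mono (nhdsWithin_le_nhds (s := Set.Ioi 0))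
  have h2 : ∀ᶠ ε : ℝ in 𝓝[>] 0, ε ∈ Set.Ioo (0 : ℝ) (1 / 2) := Ioo_mem_nhdsGT (by norm_num)
  obtain ⟨ε, h3, h4⟩ := (h1.and h2).exists
  exact ⟨ε, h4.1, h4.2, h3⟩

section PathBandit

variable {L K : ℕ} (hL : 0 < L) (hdvd : K ∣ L) (μ : Fin (L / K) → unitInterval)
  (alg : Algorithm)

theorem expectedCount_eq (B : Bandit L) (A : Finset (Fin L)) (n : ℕ) :
    alg.expectedCount B A n = ∫ h, Policy.visits A h ∂(alg.law B n) := rfl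

theorem expectedCount_nonneg (B : Bandit L) (A : Finset (Fin L)) (n : ℕ) :
    0 ≤ alg.expectedCount B A n :=
  integral_nonneg fun h => Policy.visits_nonneg A h

theorem sum_expectedCount (n : ℕ) :
    ∑ i : Fin (L / K), alg.expectedCount (pathBandit hL hdvd μ) (path L K i) n = n := by
  rw [← sum_pathBandit hL hdvd μ fun A => alg.expectedCount (pathBandit hL hdvd μ) A n]
  simp only [expectedCount_eq]
  rw [← integral_finsetSum (μ := alg.law (pathBandit hL hdvd μ) n) _ fun A _ =>
    Policy.integrable_visits _ _ n _]
  simp only [Policy.sum_visits]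
  have : IsProbabilityMeasure (alg.law (pathBandit hL hdvd μ) n) :=
    Policy.isProbabilityMeasure_law _ _ n
  simp

/-- The information inequality for path semi-bandits that differ in the mean of path `j`. -/
theorem expectedCount_information (j : Fin (L / K)) (q' : unitInterval) (h0 : 0 < (μ j : ℝ))
    (h1 : (μ j : ℝ) < 1) (h0' : 0 < (q' : ℝ)) (h1' : (q' : ℝ) < 1) {n : ℕ} (hn : 0 < n)
    (s : ℝ) :
    s * (1 - alg.expectedCount (pathBandit hL hdvd μ) (path L K j) n / n) ≤
      (μ j - q') ^ 2 / (q' * (1 - q')) *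
          alg.expectedCount (pathBandit hL hdvd μ) (path L K j) n +
        Real.exp s / n * ∑ i ∈ Finset.univ.erase j,
          alg.expectedCount (pathBandit hL hdvd (Function.update μ j q')) (path L K i) n := by
  have hn' : (0 : ℝ) < n := Nat.cast_pos.2 hn
  have key := (alg L (pathBandit hL hdvd μ).Θ (pathBandit hL hdvd μ).nonempty).information_le
    (a := ⟨path L K j, (mem_pathBandit hL hdvd μ).2 ⟨j, rfl⟩⟩)
    ((measurable_bernoulliRatio (μ j) q').comp (measurable_pi_apply (firstItem hdvd hL j)))
    (lt_min (div_pos h0' h0) (div_pos (sub_pos.2 h1') (sub_pos.2 h1)))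
    (fun w => le_bernoulliRatio _ _ _) (fun w => bernoulliRatio_le _ _ _)
    (isRatio_pathBandit hL hdvd μ j q' h0 h1 _ rfl) hn s
  have hint := integral_inv_bernoulliRatio hL hdvd μ j h1 h0' h1'
  simp only [Function.comp_apply, hint] at key
  refine key.trans (add_le_add le_rfl (le_of_eq ?_))
  have hsum := sum_expectedCount hL hdvd (Function.update μ j q') alg n
  rw [← Finset.add_sum_erase _ _ (Finset.mem_univ j)] at hsum
  rw [← eq_sub_iff_add_eq'] at hsum
  rw [hsum, div_mul_eq_mul_div, mul_div_assoc, sub_div, div_self hn'.ne']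
  -- Both semi-bandits have the same feasible set, so `alg` runs the same policy on both.
  rfl

theorem eventually_mul_log_le_expectedCount {alg : Algorithm} (hcons : alg.IsConsistent)
    (j : Fin (L / K)) {q' : unitInterval} (h0 : 0 < (μ j : ℝ)) (h1 : (μ j : ℝ) < 1)
    (hq : ∀ i ≠ j, μ i < q') (h0' : 0 < (q' : ℝ)) (h1' : (q' : ℝ) < 1) {y : ℝ} (hy : 0 ≤ y)
    (hyκ : y * ((μ j - q') ^ 2 / (q' * (1 - q'))) < 1) :
    ∀ᶠ n : ℕ in atTop,
      y * Real.log n ≤ alg.expectedCount (pathBandit hL hdvd μ) (path L K j) n := by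
  set κ : ℝ := (μ j - q') ^ 2 / (q' * (1 - q')) with hκdef
  have hκ : 0 ≤ κ := div_nonneg (sq_nonneg _) (mul_nonneg h0'.le (sub_nonneg.2 h1'.le))
  -- Then `1 - α` is the midpoint of `y * κ` and `1`, so `y * κ < 1 - α` with `α > 0`.
  let α : ℝ := (1 - y * κ) / 2
  have hα0 : 0 < α := by simp only [α]; linarith
  have hα1 : α ≤ 1 := by
    have := mul_nonneg hy hκ
    simp only [α]; linarith
  set B' := pathBandit hL hdvd (Function.update μ j q') with hB'
  have hupd : ∀ i, i ≠ j → Function.update μ j q' i < Function.update μ j q' j := fun i hi => by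
    rw [Function.update_self, Function.update_of_ne hi]; exact hq i hi
  have hδ : Tendsto (fun n : ℕ => ∑ i ∈ Finset.univ.erase j,
      alg.expectedCount B' (path L K i) n / (n : ℝ) ^ α) atTop (𝓝 0) := by
    rw [← Finset.sum_const_zero (s := Finset.univ.erase j)]
    refine tendsto_finsetSum _ fun i hi => ?_
    refine (hcons L B' (hasUniqueOptimum_pathBandit hL hdvd _ hupd) (path L K i)
      ((mem_pathBandit hL hdvd _).2 ⟨i, rfl⟩) ?_ α hα0).tendsto_div_nhds_zero
    rw [hB', isOptimal_path_iff]
    exact fun h => (h j).not_gt (hupd i (Finset.ne_of_mem_erase hi))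
  refine eventually_mul_log_le (α := α) hα1 hκ (by simp only [α]; linarith) hδ ?_
  filter_upwards [eventually_gt_atTop 0] with n hn
  have hn' : (0 : ℝ) < n := Nat.cast_pos.2 hn
  -- With `s = (1 - α) log n` the factor `exp s / n` is `n ^ (-α)`, exactly the rate that
  -- consistency under the alternative beats.
  have key := expectedCount_information hL hdvd μ alg j q' h0 h1 h0' h1' hn
    ((1 - α) * Real.log n)
  have he : Real.exp ((1 - α) * Real.log n) / n = ((n : ℝ) ^ α)⁻¹ := by
    rw [mul_comm, ← Real.rpow_def_of_pos hn', Real.rpow_sub hn', Real.rpow_one]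
    field_simp
  rw [he, Finset.mul_sum] at key
  simpa only [κ, B', div_eq_inv_mul] using key

/-! ### Decomposition of the regret by solutions. -/

theorem ret_eval_le (A : Finset (Fin L)) (w : Weights L) : |ret A fun e => (w e : ℝ)| ≤ L := by
  have h0 : 0 ≤ ret A fun e => (w e : ℝ) := Finset.sum_nonneg fun e _ => (w e).2.1
  rw [abs_of_nonneg h0]
  calc ret A (fun e => (w e : ℝ)) ≤ ∑ _e ∈ A, (1 : ℝ) :=
        Finset.sum_le_sum fun e _ => (w e).2.2
    _ ≤ L := by
        simpa using (Finset.card_le_univ A)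

theorem measurable_ret (A : Finset (Fin L)) :
    Measurable fun w : Weights L => ret A fun e => (w e : ℝ) :=
  Finset.measurable_sum _ fun e _ => measurable_subtype_coe.comp (measurable_pi_apply e)

theorem integral_ret (B : Bandit L) (A : Finset (Fin L)) :
    ∫ w, ret A (fun e => (w e : ℝ)) ∂(B.P : Measure (Weights L)) = ret A B.mean := by
  unfold ret Bandit.mean
  refine integral_finsetSum _ fun e _ => ?_
  exact Integrable.of_bound
    (measurable_subtype_coe.comp (measurable_pi_apply e)).aestronglyMeasurable 1
    (.of_forall fun w => by
      rw [Real.norm_of_nonneg (w e).2.1]; exact (w e).2.2)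

/-- The regret is the sum over the solutions of the gap times the expected number of visits. -/
theorem regret_eq_sum (B : Bandit L) (n : ℕ) :
    alg.regret B n =
      ∑ A : B.Θ, (ret B.optimal B.mean - ret A.1 B.mean) * alg.expectedCount B A.1 n := by
  let φ : Round B.Θ → ℝ := fun r =>
    ret B.optimal (fun e => (r.2 e : ℝ)) - ret r.1.1 fun e => (r.2 e : ℝ)
  have hφ : Measurable φ := measurable_from_prod_countable_right fun A =>
    (measurable_ret B.optimal).sub (measurable_ret A.1)
  have hb : ∀ r, |φ r| ≤ L + L := fun r =>
    (abs_sub _ _).trans (add_le_add (ret_eval_le _ _) (ret_eval_le _ _))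
  have hi : ∀ A : Finset (Fin L), Integrable (fun w : Weights L => ret A fun e => (w e : ℝ))
      (B.P : Measure (Weights L)) := fun A =>
    Integrable.of_bound (measurable_ret A).aestronglyMeasurable L (.of_forall (ret_eval_le A))
  refine ((alg L B.Θ B.nonempty).integral_sum_comp B.P n hφ hb).trans ?_
  refine Finset.sum_congr rfl fun A _ => ?_
  simp only [φ]
  rw [integral_sub (hi _) (hi _), integral_ret, integral_ret]
  rfl

theorem ret_optimal_eq {B : Bandit L} {A : Finset (Fin L)} (hA : B.IsOptimal A) :
    ret B.optimal B.mean = ret A B.mean :=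
  le_antisymm (hA.2 _ B.exists_isOptimal.choose_spec.1)
    (B.exists_isOptimal.choose_spec.2 _ hA.1)

theorem regret_pathBandit {i₀ : Fin (L / K)} (h : ∀ i, μ i ≤ μ i₀) (n : ℕ) :
    alg.regret (pathBandit hL hdvd μ) n =
      ∑ i, K * ((μ i₀ : ℝ) - μ i) *
        alg.expectedCount (pathBandit hL hdvd μ) (path L K i) n := by
  rw [regret_eq_sum, ret_optimal_eq ((isOptimal_path_iff hL hdvd μ i₀).2 h),
    sum_pathBandit hL hdvd μ fun A => (ret (path L K i₀) (pathBandit hL hdvd μ).mean -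
      ret A (pathBandit hL hdvd μ).mean) * alg.expectedCount (pathBandit hL hdvd μ) A n]
  simp only [ret_path_mean, mul_sub]

end PathBandit

/-! ### The `K`-path semi-bandit and the final bound. -/

section KPath

variable {L K : ℕ} (hL : 0 < L) (hdvd : K ∣ L) {Δ : ℝ} (h0 : 0 < Δ / K) (h1 : Δ / K < 1 / 2)

theorem regret_kPath {i₀ : Fin (L / K)} (hi₀ : (i₀ : ℕ) = 0) (alg : Algorithm) (n : ℕ) :
    alg.regret (kPath hL hdvd Δ h0 h1) n = ∑ i ∈ Finset.univ.erase i₀,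
      Δ * alg.expectedCount (kPath hL hdvd Δ h0 h1) (path L K i) n := by
  have hK : (K : ℝ) ≠ 0 := Nat.cast_ne_zero.2 (Nat.pos_of_dvd_of_pos hdvd hL).ne'
  rw [kPath_eq_pathBandit, regret_pathBandit hL hdvd _ alg (i₀ := i₀),
    ← Finset.add_sum_erase _ _ (Finset.mem_univ i₀), sub_self, mul_zero, zero_mul, zero_add]
  · refine Finset.sum_congr rfl fun i hi => ?_
    have : (i : ℕ) ≠ 0 := fun h => Finset.ne_of_mem_erase hi (Fin.ext (h.trans hi₀.symm))
    simp only [pathMean, hi₀, this, if_true, if_false, sub_sub_cancel]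
    rw [mul_div_cancel₀ _ hK]
  · intro i
    rw [← Subtype.coe_le_coe]
    simp only [pathMean, hi₀, if_true]
    split_ifs <;> linarith

theorem eventually_mul_log_le_expectedCount_kPath {alg : Algorithm} (hcons : alg.IsConsistent)
    {j : Fin (L / K)} (hj : (j : ℕ) ≠ 0) {y : ℝ} (hy : 0 ≤ y)
    (hyd : y < 1 / (4 * (Δ / K) ^ 2)) :
    ∀ᶠ n : ℕ in atTop,
      y * Real.log n ≤ alg.expectedCount (kPath hL hdvd Δ h0 h1) (path L K j) n := by
  obtain ⟨ε, hε0, hε1, hε⟩ := exists_alternative_gap h0 hyd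
  have hμ : (pathMean K Δ h0 h1 j : ℝ) = 1 / 2 - Δ / K := by simp [pathMean, hj]
  rw [kPath_eq_pathBandit]
  refine eventually_mul_log_le_expectedCount hL hdvd _ hcons j
    (q' := ⟨1 / 2 + ε, by constructor <;> linarith⟩) ?_ ?_ ?_ ?_ ?_ hy ?_
  · rw [hμ]; linarith
  · rw [hμ]; linarith
  · intro i _
    rw [← Subtype.coe_lt_coe]
    simp only [pathMean]
    split_ifs <;> linarith
  · simp only; linarith
  · simp only; linarith
  · rw [hμ]; exact hε

end KPath

end SemiBandit

theorem mainTheorem3 (L K : ℕ) (hL : 0 < L) (hdvd : K ∣ L) (Δ : ℝ)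
    (h0 : 0 < Δ / K) (h1 : Δ / K < 1 / 2)
    (alg : SemiBandit.Algorithm) (hcons : alg.IsConsistent) :
    ((((L : ℝ) - K) * K / (4 * Δ) : ℝ) : EReal) ≤
      liminf (fun n : ℕ =>
        ((alg.regret (SemiBandit.kPath hL hdvd Δ h0 h1) n / Real.log n : ℝ) : EReal)) atTop := by
  have hK0 := Nat.pos_of_dvd_of_pos hdvd hL
  have hK : (0 : ℝ) < K := Nat.cast_pos.2 hK0
  have hΔ : 0 < Δ := by
    have := mul_pos h0 hK
    rwa [div_mul_cancel₀ _ hK.ne'] at this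
  have hm : 0 < L / K := Nat.div_pos (Nat.le_of_dvd hL hdvd) hK0
  let i₀ : Fin (L / K) := ⟨0, hm⟩
  have hreg := SemiBandit.regret_kPath hL hdvd h0 h1 (i₀ := i₀) rfl alg
  refine EReal.ge_of_forall_gt_iff_ge.1 fun z hz => ?_
  rw [EReal.coe_lt_coe_iff] at hz
  refine le_liminf_of_le (by isBoundedDefault) ?_
  simp only [EReal.coe_le_coe_iff]
  have hlog : ∀ᶠ n : ℕ in atTop, 0 < Real.log n :=
    (Real.tendsto_log_atTop.comp tendsto_natCast_atTop_atTop).eventually_gt_atTop 0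
  -- Nonpositive `z` needs only nonnegative regret; this includes the case of a single path, where
  -- the bound is `0`.
  rcases le_or_gt z 0 with hz0 | hz0
  · filter_upwards [hlog] with n hn
    refine hz0.trans (div_nonneg ?_ hn.le)
    rw [hreg]
    exact Finset.sum_nonneg fun i _ =>
      mul_nonneg hΔ.le (SemiBandit.expectedCount_nonneg alg _ _ n)
  · obtain ⟨m, rfl⟩ := hdvd
    have hmK : K * m / K = m := Nat.mul_div_cancel_left m hK0
    rw [hmK] at hm
    push_cast at hz
    have hM : (0 : ℝ) < m - 1 := by
      by_contra! hle
      have : ((K : ℝ) * m - K) * K / (4 * Δ) ≤ 0 :=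
        div_nonpos_of_nonpos_of_nonneg (by nlinarith [mul_nonneg hK.le hK.le]) (by linarith)
      linarith
    -- The target `z` is split equally among the `m - 1` suboptimal paths, each visit costing `Δ`.
    have hy : z / (Δ * (m - 1)) < 1 / (4 * (Δ / K) ^ 2) := by
      rw [div_lt_iff₀ (mul_pos hΔ hM)]
      refine hz.trans_eq ?_
      field_simp
    have hall : ∀ᶠ n : ℕ in atTop, ∀ i ∈ Finset.univ.erase i₀,
        z / (Δ * (m - 1)) * Real.log n ≤
          alg.expectedCount (SemiBandit.kPath hL ⟨m, rfl⟩ Δ h0 h1)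
            (SemiBandit.path (K * m) K i) n := by
      rw [Filter.eventually_all_finset]
      intro i hi
      exact SemiBandit.eventually_mul_log_le_expectedCount_kPath hL ⟨m, rfl⟩ h0 h1 hcons
        (fun h => Finset.ne_of_mem_erase hi (Fin.ext h))
        (div_nonneg hz0.le (mul_pos hΔ hM).le) hy
    filter_upwards [hlog, hall] with n hn hT
    rw [le_div_iff₀ hn, hreg]
    have hcard : ((Finset.univ.erase i₀).card : ℝ) = m - 1 := by
      rw [Finset.card_erase_of_mem (Finset.mem_univ _), Finset.card_univ, Fintype.card_fin,
        hmK, Nat.cast_sub hm, Nat.cast_one]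
    refine le_trans (le_of_eq ?_) (Finset.sum_le_sum fun i hi =>
      mul_le_mul_of_nonneg_left (hT i hi) hΔ.le)
    rw [Finset.sum_const, nsmul_eq_mul, hcard]
    field_simp
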